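/- Let $\mathbb{D}=\{|z|<1\}$ and $\mathbb{T}=\partial\mathbb{D}$. Let $H^2$ be the Hardy space of $\mathbb{D}$, identified through boundary values with the closed subspace of $L^2(\mathbb{T})$ of functions whose Fourier coefficients of negative index vanish, and let $H^\infty$ be the space of bounded analytic functions on $\mathbb{D}$. Let $P$ be the orthogonal projection of $L^2(\mathbb{T})$ onto $H^2$. For a polynomial $a$, let $T_{\overline{a}}f=P(\overline{a}f)$ for $f\in H^2$, and let $\mathscr{M}(\overline{a})=T_{\overline{a}}H^2$, regarded as a set of analytic functions on $\mathbb{D}$. Let $\mathscr{A}$ be the set of polynomials $a(z)=\prod_{j=1}^{N}(z-\zeta_j)$ with $N\ge 0$ and $\zeta_1,\dots,\zeta_N\in\mathbb{T}$ (repetitions allowed; $a=1$ if $N=0$). For $a_1,a_2\in\mathscr{A}$, let $$\mathfrak{M}(\overline{a_1},\overline{a_2})=\{\varphi \text{ analytic on } \mathbb{D} : \varphi f\in\mathscr{M}(\overline{a_2}) \text{ for every } f\in\mathscr{M}(\overline{a_1})\}.$$ **Theorem.** Suppose that $a_1,a_2\in\mathscr{A}$ and $h=a_1/a_2\in H^\infty$.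 Then $$\mathfrak{M}(\overline{a_1},\overline{a_2})=\{\varphi\in\mathscr{M}(\overline{a_2}) : h\varphi\in H^\infty\}.$$ -/

import Mathlib

open scoped Complex.UnitDisc
open MeasureTheory AddCircle

namespace CoanalyticToeplitz

noncomputable section

/-- Normalized Lebesgue measure on the unit circle, which is parametrized by
`t ↦ e ^ (2 π i t)` with `t` in `ℝ / ℤ`. -/
abbrev circleMeasure : Measure UnitAddCircle := haarAddCircle

/-- The space `L²` of the unit circle. -/
abbrev L2 : Type := Lp ℂ 2 circleMeasure

/-- The space `L^∞` of the unit circle. -/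
abbrev LInf : Type := Lp ℂ ⊤ circleMeasure

/-- The Hardy space `H²`, as the space of boundary functions: the functions in `L²` of the circle
all of whose Fourier coefficients of negative index vanish. -/
def H2 : Submodule ℂ L2 where
  carrier := {f | ∀ n : ℤ, n < 0 → fourierCoeff f n = 0}
  zero_mem' := by
    intro n _
    rw [← fourierBasis_repr]
    simp
  add_mem' := by
    intro f g hf hg n hn
    have h1 := hf n hn
    have h2 := hg n hn
    rw [← fourierBasis_repr] at h1 h2 ⊢
    simp [h1, h2]
  smul_mem' := by
    intro c f hf n hn
    have h1 := hf n hn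
    rw [← fourierBasis_repr] at h1 ⊢
    simp [h1]

theorem isClosed_H2 : IsClosed (H2 : Set L2) := by
  have h : (H2 : Set L2) =
      ⋂ (n : ℤ) (_ : n < 0), {f : L2 | inner ℂ (fourierLp 2 n : L2) f = 0} := by
    ext f
    simp only [Set.mem_iInter, Set.mem_ofPred_eq]
    refine forall_congr' fun n => forall_congr' fun _ => ?_
    rw [← fourierBasis_repr, HilbertBasis.repr_apply_apply, coe_fourierBasis]
  rw [h]
  exact isClosed_iInter fun n => isClosed_iInter fun _ =>
    isClosed_eq (by fun_prop) continuous_const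

instance : CompleteSpace H2 := isClosed_H2.completeSpace_coe

/-- The analytic function on the open unit disk with boundary function `f ∈ H²`: its Taylor
coefficients at the origin are the Fourier coefficients of `f`. -/
def toDisk (f : H2) : 𝔻 → ℂ :=
  fun z => ∑' n : ℕ, fourierCoeff (f : L2) (n : ℤ) * (z : ℂ) ^ n

/-- The Toeplitz operator `f ↦ P (ψ f)` on `H²` with symbol `ψ ∈ L^∞`, where `P` is the orthogonal
projection of `L²` onto `H²`. -/
def toeplitz (ψ : LInf) (f : H2) : H2 :=
  H2.orthogonalProjectionOnto (ψ • (f : L2) : L2)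

/-- The complex conjugate on the unit circle of a polynomial `a`, as an element of `L^∞`. -/
def conjSymbol (a : Polynomial ℂ) : LInf :=
  ContinuousMap.toLp ⊤ circleMeasure ℂ
    ⟨fun t : UnitAddCircle => starRingEnd ℂ (a.eval (t.toCircle : ℂ)), by fun_prop⟩

/-- The range of the co-analytic Toeplitz operator with symbol the conjugate of `a`, as a set of
functions on the open unit disk. -/
def rangeSpace (a : Polynomial ℂ) : Set (𝔻 → ℂ) :=
  {g | ∃ f : H2, g = toDisk (toeplitz (conjSymbol a) f)}

/-- `φ` is analytic on the open unit disk. -/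
def IsAnalytic (φ : 𝔻 → ℂ) : Prop :=
  ∃ F : ℂ → ℂ, DifferentiableOn ℂ F (Metric.ball 0 1) ∧ ∀ z : 𝔻, φ z = F z

/-- The space `H^∞` of bounded analytic functions on the open unit disk. -/
def HInf : Set (𝔻 → ℂ) :=
  {φ | IsAnalytic φ ∧ ∃ C : ℝ, ∀ z : 𝔻, ‖φ z‖ ≤ C}

/-- The analytic functions on the disk that multiply every element of `rangeSpace a₁` into
`rangeSpace a₂`. -/
def multipliers (a₁ a₂ : Polynomial ℂ) : Set (𝔻 → ℂ) :=
  {φ | IsAnalytic φ ∧ ∀ f ∈ rangeSpace a₁, φ * f ∈ rangeSpace a₂}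

/-- The polynomials `(z - ζ₁) ⋯ (z - ζ_N)` with `ζ₁, …, ζ_N` on the unit circle, repetitions
allowed; the empty product `1` is included. -/
def classA : Set (Polynomial ℂ) :=
  {a | ∃ (N : ℕ) (ζ : Fin N → Circle), a = ∏ j, (Polynomial.X - Polynomial.C (ζ j : ℂ))}

/-- The quotient `a₁ / a₂` as a function on the disk. -/
def quotient (a₁ a₂ : Polynomial ℂ) : 𝔻 → ℂ :=
  fun z => a₁.eval (z : ℂ) / a₂.eval (z : ℂ)

end

end CoanalyticToeplitz

/-!
For `a ∈ classA` of degree `N`, on the circle `conj a` is a nonzero constant times `z ^ (-N) a`.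
Hence `P (conj a f)` is, up to a constant, the function whose Taylor series is that of `a f` shifted
by `N`. As `a` is coprime to `X ^ N`, the range of the Toeplitz operator is `a H² + ℂ[X]`
(`mem_rangeSpace_iff`); everything else uses this description only.

Since `a₁ / a₂` is bounded on the disk, `a₂ ∣ a₁` (`dvd_of_bounded_quotient`); write `a₁ = a₂ b`,
so that `h = b`.

* If `φ` is a multiplier, then `φ = φ · 1` lies in the range for `a₂`, and in particular in `H²`.
  For `f ∈ H²`, `a₂ b f φ = a₂ g + p` with `g ∈ H²` and a polynomial `p`, so `p / a₂ = b f φ - g`.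
  Functions in `H²` are `o((1 - r) ^ (-1/2))` along radii (`SquareSummable.tendsto_radial`), so
  `p / a₂` is `o(1 / (1 - r))`. It therefore has no pole on the circle, that is, `a₂ ∣ p`
  (`dvd_of_tendsto`). So `b φ` multiplies `H²` into itself (`mul_toDisk_mem_range`), and it is
  bounded by the closed graph theorem and the reproducing kernel (`bounded_of_mul_mem`).
* Conversely, let `φ = a₂ k + q` with `k ∈ H²`, a polynomial `q`, and `b φ` bounded. Then
  `φ (a₁ g + p) = a₂ ((b φ) g + k p) + q p`, and `(b φ) g ∈ H²` because bounded analytic functions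
  multiply `H²` into itself (`SquareSummable.mul_of_bounded`, from Parseval's identity on the
  circles of radius `r < 1`).

Elements of `H²` are handled through their Taylor series, as square-summable elements of
`PowerSeries ℂ`; divisibility by `X ^ N` and multiplication by polynomials are then algebraic.
-/

namespace CoanalyticToeplitz

/-! ### Power series on the disk -/

/-- The sum at `z` of the power series `F`; zero where the series diverges. -/
noncomputable def diskSum (F : PowerSeries ℂ) (z : ℂ) : ℂ :=
  ∑' n : ℕ, PowerSeries.coeff n F * z ^ n

/-- The power series `F` converges at every point of the open unit disk. -/
def ConvergesOnDisk (F : PowerSeries ℂ) : Prop :=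
  ∀ z : ℂ, ‖z‖ < 1 → Summable fun n => PowerSeries.coeff n F * z ^ n

theorem ConvergesOnDisk.mul {F G : PowerSeries ℂ} (hF : ConvergesOnDisk F)
    (hG : ConvergesOnDisk G) : ConvergesOnDisk (F * G) := by
  intro z hz
  have h := summable_norm_sum_mul_antidiagonal_of_summable_norm (hF z hz).norm (hG z hz).norm
  refine h.of_norm.congr fun n => ?_
  rw [PowerSeries.coeff_mul, Finset.sum_mul]
  refine Finset.sum_congr rfl fun ij hij => ?_
  rw [← Finset.HasAntidiagonal.mem_antidiagonal.1 hij, pow_add]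
  ring

theorem diskSum_mul {F G : PowerSeries ℂ} (hF : ConvergesOnDisk F) (hG : ConvergesOnDisk G)
    {z : ℂ} (hz : ‖z‖ < 1) : diskSum (F * G) z = diskSum F z * diskSum G z := by
  unfold diskSum
  rw [tsum_mul_tsum_eq_tsum_sum_antidiagonal_of_summable_norm (hF z hz).norm (hG z hz).norm]
  refine tsum_congr fun n => ?_
  rw [PowerSeries.coeff_mul, Finset.sum_mul]
  refine Finset.sum_congr rfl fun ij hij => ?_
  rw [← Finset.HasAntidiagonal.mem_antidiagonal.1 hij, pow_add]
  ring

theorem ConvergesOnDisk.add {F G : PowerSeries ℂ} (hF : ConvergesOnDisk F)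
    (hG : ConvergesOnDisk G) : ConvergesOnDisk (F + G) := by
  intro z hz
  simpa [add_mul] using (hF z hz).add (hG z hz)

theorem diskSum_add {F G : PowerSeries ℂ} (hF : ConvergesOnDisk F) (hG : ConvergesOnDisk G)
    {z : ℂ} (hz : ‖z‖ < 1) : diskSum (F + G) z = diskSum F z + diskSum G z := by
  unfold diskSum
  simp only [map_add, add_mul]
  exact (hF z hz).tsum_add (hG z hz)

theorem hasSum_coe_polynomial (p : Polynomial ℂ) (z : ℂ) :
    HasSum (fun n => PowerSeries.coeff n (p : PowerSeries ℂ) * z ^ n) (p.eval z) := by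
  rw [Polynomial.eval_eq_sum_range]
  simp only [Polynomial.coeff_coe]
  refine hasSum_sum_of_ne_finset_zero fun n hn => ?_
  rw [Polynomial.coeff_eq_zero_of_natDegree_lt (by simpa using hn), zero_mul]

theorem convergesOnDisk_coe (p : Polynomial ℂ) : ConvergesOnDisk (p : PowerSeries ℂ) :=
  fun z _ => (hasSum_coe_polynomial p z).summable

theorem diskSum_coe (p : Polynomial ℂ) (z : ℂ) : diskSum (p : PowerSeries ℂ) z = p.eval z :=
  (hasSum_coe_polynomial p z).tsum_eq

theorem ConvergesOnDisk.hasFPowerSeriesOnBall {F : PowerSeries ℂ} (hF : ConvergesOnDisk F) :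
    HasFPowerSeriesOnBall (diskSum F)
      (FormalMultilinearSeries.ofScalars ℂ fun n => PowerSeries.coeff n F) 0 1 where
  r_le := by
    refine ENNReal.le_of_forall_nnreal_lt fun r hr => ?_
    have hr1 : (r : ℝ) < 1 := by exact_mod_cast hr
    refine FormalMultilinearSeries.le_radius_of_summable _ ?_
    refine (hF (r : ℂ) (by simpa using hr1)).norm.congr fun n => ?_
    rw [FormalMultilinearSeries.ofScalars_norm]
    simp
  r_pos := one_pos
  hasSum := by
    intro z hz
    have hz1 : ‖z‖ < 1 := by
      rwa [← ENNReal.ofReal_one, Metric.eball_ofReal, mem_ball_zero_iff] at hz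
    simpa [FormalMultilinearSeries.ofScalars_apply_eq, diskSum, mul_comm] using (hF z hz1).hasSum

theorem ConvergesOnDisk.differentiableOn {F : PowerSeries ℂ} (hF : ConvergesOnDisk F) :
    DifferentiableOn ℂ (diskSum F) (Metric.ball 0 1) := by
  have h := hF.hasFPowerSeriesOnBall.differentiableOn
  rwa [← ENNReal.ofReal_one, Metric.eball_ofReal] at h

theorem ConvergesOnDisk.ext {F G : PowerSeries ℂ} (hF : ConvergesOnDisk F)
    (hG : ConvergesOnDisk G) (h : ∀ z : 𝔻, diskSum F z = diskSum G z) : F = G := by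
  have hG' : HasFPowerSeriesOnBall (diskSum F) _ 0 1 :=
    hG.hasFPowerSeriesOnBall.congr fun z hz => by
      rw [← ENNReal.ofReal_one, Metric.eball_ofReal, mem_ball_zero_iff] at hz
      exact (h (.mk z hz)).symm
  have := hF.hasFPowerSeriesOnBall.hasFPowerSeriesAt.eq_formalMultilinearSeries
    hG'.hasFPowerSeriesAt
  rw [FormalMultilinearSeries.ofScalars_series_eq_iff] at this
  ext n
  exact congrFun this n

theorem isAnalytic_iff {φ : 𝔻 → ℂ} :
    IsAnalytic φ ↔ ∃ F : PowerSeries ℂ, ConvergesOnDisk F ∧ ∀ z : 𝔻, φ z = diskSum F z := by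
  constructor
  · rintro ⟨f, hf, hφ⟩
    have key : ∀ z : ℂ, ‖z‖ < 1 → HasSum (fun n => PowerSeries.coeff n
        (PowerSeries.mk fun n => (n.factorial : ℂ)⁻¹ * iteratedDeriv n f 0) * z ^ n) (f z) := by
      intro z hz
      have := Complex.hasSum_taylorSeries_on_ball hf (z := z) (by simpa using hz)
      refine this.congr_fun fun n => ?_
      simp
      ring
    exact ⟨_, fun z hz => (key z hz).summable, fun z => by
      rw [hφ z]; exact (key z z.norm_lt_one).tsum_eq.symm⟩
  · rintro ⟨F, hF, h⟩
    exact ⟨diskSum F, hF.differentiableOn, h⟩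

/-! ### Square-summable power series and the Hardy space -/

/-- The coefficients of the power series `F` are square-summable. -/
def SquareSummable (F : PowerSeries ℂ) : Prop :=
  Summable fun n => ‖PowerSeries.coeff n F‖ ^ 2

theorem SquareSummable.add {F G : PowerSeries ℂ} (hF : SquareSummable F)
    (hG : SquareSummable G) : SquareSummable (F + G) := by
  refine .of_nonneg_of_le (fun n => by positivity) (fun n => ?_)
    ((hF.mul_left 2).add (hG.mul_left 2))
  rw [map_add]
  have h := norm_add_le (PowerSeries.coeff n F) (PowerSeries.coeff n G)
  nlinarith [norm_nonneg (PowerSeries.coeff n F + PowerSeries.coeff n G),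
    sq_nonneg (‖PowerSeries.coeff n F‖ - ‖PowerSeries.coeff n G‖)]

theorem SquareSummable.C_mul {F : PowerSeries ℂ} (hF : SquareSummable F) (c : ℂ) :
    SquareSummable (PowerSeries.C c * F) := by
  refine (hF.mul_left (‖c‖ ^ 2)).congr fun n => ?_
  rw [PowerSeries.coeff_C_mul, norm_mul, mul_pow]

theorem squareSummable_X_pow_mul {F : PowerSeries ℂ} (N : ℕ) :
    SquareSummable (PowerSeries.X ^ N * F) ↔ SquareSummable F := by
  unfold SquareSummable
  rw [← summable_nat_add_iff N]
  simp [PowerSeries.coeff_X_pow_mul]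

theorem squareSummable_coe (p : Polynomial ℂ) : SquareSummable (p : PowerSeries ℂ) := by
  refine summable_of_ne_finset_zero (s := Finset.range (p.natDegree + 1)) fun n hn => ?_
  rw [Polynomial.coeff_coe, Polynomial.coeff_eq_zero_of_natDegree_lt (by simpa using hn)]
  simp

theorem SquareSummable.coe_mul {F : PowerSeries ℂ} (hF : SquareSummable F) (p : Polynomial ℂ) :
    SquareSummable ((p : PowerSeries ℂ) * F) := by
  induction p using Polynomial.induction_on' with
  | add p q hp hq => rw [Polynomial.coe_add, add_mul]; exact hp.add hq
  | monomial n c =>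
    rw [← Polynomial.C_mul_X_pow_eq_monomial]
    simp only [Polynomial.coe_mul, Polynomial.coe_C, Polynomial.coe_pow, Polynomial.coe_X,
      mul_assoc]
    exact ((squareSummable_X_pow_mul n).2 hF).C_mul c

theorem SquareSummable.convergesOnDisk {F : PowerSeries ℂ} (hF : SquareSummable F) :
    ConvergesOnDisk F := by
  intro z hz
  have hz2 : ‖z‖ ^ 2 < 1 := by nlinarith [norm_nonneg z]
  refine .of_norm_bounded (Summable.add hF (summable_geometric_of_lt_one (by positivity) hz2))
    fun n => ?_
  rw [norm_mul, norm_pow, ← pow_mul, mul_comm 2 n, pow_mul]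
  nlinarith [sq_nonneg (‖PowerSeries.coeff n F‖ - ‖z‖ ^ n), sq_nonneg (‖PowerSeries.coeff n F‖),
    sq_nonneg (‖z‖ ^ n)]

theorem SquareSummable.diskSum_coe_mul_add {G : PowerSeries ℂ} (hG : SquareSummable G)
    (a p : Polynomial ℂ) (z : 𝔻) :
    diskSum ((a : PowerSeries ℂ) * G + (p : PowerSeries ℂ)) z =
      a.eval (z : ℂ) * diskSum G z + p.eval (z : ℂ) := by
  rw [diskSum_add (hG.coe_mul a).convergesOnDisk (convergesOnDisk_coe p) z.norm_lt_one,
    diskSum_mul (convergesOnDisk_coe a) hG.convergesOnDisk z.norm_lt_one, diskSum_coe, diskSum_coe]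

/-- The Taylor series at the origin of the function on the disk with boundary function `f`. -/
noncomputable def taylor (f : H2) : PowerSeries ℂ :=
  PowerSeries.mk fun n => fourierCoeff (f : L2) (n : ℤ)

theorem neg_of_notMem_range_natCast {m : ℤ} (hm : m ∉ Set.range ((↑) : ℕ → ℤ)) : m < 0 := by
  by_contra! h0
  exact hm ⟨m.toNat, by simp [h0]⟩

theorem toDisk_eq_diskSum (f : H2) (z : 𝔻) : toDisk f z = diskSum (taylor f) z := by
  simp [toDisk, diskSum, taylor]

theorem coeff_taylor (f : H2) (n : ℕ) :
    PowerSeries.coeff n (taylor f) = fourierBasis.repr (f : L2) (n : ℤ) := by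
  simp [taylor, fourierBasis_repr]

/-- The inner product of `H²` in terms of Taylor coefficients. -/
theorem hasSum_inner (f g : H2) :
    HasSum (fun n => starRingEnd ℂ (PowerSeries.coeff n (taylor f)) *
      PowerSeries.coeff n (taylor g)) (inner ℂ f g) := by
  have h := fourierBasis.hasSum_inner_mul_inner (f : L2) (g : L2)
  rw [Submodule.coe_inner]
  refine ((Nat.cast_injective (R := ℤ)).hasSum_iff ?_).2 h |>.congr_fun fun n => ?_
  · intro m hm
    have hm' := neg_of_notMem_range_natCast hm
    rw [← HilbertBasis.repr_apply_apply, fourierBasis_repr, g.2 m hm', mul_zero]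
  · rw [Function.comp_apply, ← inner_conj_symm, ← HilbertBasis.repr_apply_apply,
      ← HilbertBasis.repr_apply_apply, fourierBasis_repr, fourierBasis_repr]
    simp [taylor]

theorem hasSum_norm_sq (f : H2) :
    HasSum (fun n => ‖PowerSeries.coeff n (taylor f)‖ ^ 2) (‖f‖ ^ 2) := by
  have h := Complex.hasSum_re (hasSum_inner f f)
  have h2 : (inner ℂ f f).re = ‖f‖ ^ 2 := inner_self_eq_norm_sq (𝕜 := ℂ) f
  rw [h2] at h
  refine h.congr_fun fun n => ?_
  rw [mul_comm, Complex.mul_conj, Complex.normSq_eq_norm_sq, Complex.ofReal_re]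

theorem squareSummable_taylor (f : H2) : SquareSummable (taylor f) :=
  (hasSum_norm_sq f).summable

theorem SquareSummable.exists_taylor_eq {F : PowerSeries ℂ} (hF : SquareSummable F) :
    ∃ f : H2, taylor f = F := by
  let c : ℤ → ℂ := fun n => if 0 ≤ n then PowerSeries.coeff n.toNat F else 0
  have hc : Memℓp c 2 := by
    rw [memℓp_gen_iff (by simp)]
    refine ((Nat.cast_injective (R := ℤ)).summable_iff ?_).1 (hF.congr fun n => by simp [c])
    intro m hm
    simp [c, neg_of_notMem_range_natCast hm]
  let l : lp (fun _ : ℤ => ℂ) 2 := ⟨c, hc⟩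
  have hl : ∀ n, fourierCoeff (fourierBasis.repr.symm l : L2) n = c n := by
    intro n
    rw [← fourierBasis_repr, LinearIsometryEquiv.apply_symm_apply]
  refine ⟨⟨fourierBasis.repr.symm l, fun n hn => ?_⟩, ?_⟩
  · rw [hl]
    simp [c, hn]
  · ext n
    simp [taylor, hl, c]

theorem taylor_injective : Function.Injective taylor := by
  intro f g h
  rw [← sub_eq_zero, ← norm_eq_zero, ← sq_eq_zero_iff]
  refine (hasSum_norm_sq (f - g)).unique ?_
  convert hasSum_zero with n
  have h' := congrArg (PowerSeries.coeff n) h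
  simp only [coeff_taylor] at h'
  simp [coeff_taylor, h']

theorem mem_range_toDisk {φ : 𝔻 → ℂ} :
    φ ∈ Set.range toDisk ↔
      ∃ F : PowerSeries ℂ, SquareSummable F ∧ ∀ z : 𝔻, φ z = diskSum F z := by
  constructor
  · rintro ⟨f, rfl⟩
    exact ⟨taylor f, squareSummable_taylor f, toDisk_eq_diskSum f⟩
  · rintro ⟨F, hF, h⟩
    obtain ⟨f, rfl⟩ := hF.exists_taylor_eq
    exact ⟨f, funext fun z => by rw [toDisk_eq_diskSum, h]⟩

/-! ### Bounded functions multiply the Hardy space into itself -/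

theorem norm_mul_toCircle_lt_one {r : ℝ} (hr0 : 0 ≤ r) (hr1 : r < 1) (t : UnitAddCircle) :
    ‖(r * (t.toCircle : ℂ))‖ < 1 := by
  rwa [norm_mul, Circle.norm_coe, mul_one, Complex.norm_real, Real.norm_of_nonneg hr0]

theorem ConvergesOnDisk.continuous_circle {F : PowerSeries ℂ} (hF : ConvergesOnDisk F) {r : ℝ}
    (hr0 : 0 ≤ r) (hr1 : r < 1) :
    Continuous fun t : UnitAddCircle => diskSum F (r * (t.toCircle : ℂ)) := by
  refine hF.differentiableOn.continuousOn.comp_continuous (by fun_prop) fun t => ?_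
  exact mem_ball_zero_iff.2 (norm_mul_toCircle_lt_one hr0 hr1 t)

/-- Parseval's identity on the circle of radius `r`. -/
theorem ConvergesOnDisk.hasSum_circle {F : PowerSeries ℂ} (hF : ConvergesOnDisk F) {r : ℝ}
    (hr0 : 0 ≤ r) (hr1 : r < 1) :
    HasSum (fun n => (‖PowerSeries.coeff n F‖ * r ^ n) ^ 2)
      (∫ t : UnitAddCircle, ‖diskSum F (r * (t.toCircle : ℂ))‖ ^ 2 ∂circleMeasure) := by
  have hnr : ‖(r : ℂ)‖ < 1 := by simpa [abs_of_nonneg hr0] using hr1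
  have hs : Summable fun n => ‖PowerSeries.coeff n F‖ * r ^ n := by
    simpa [abs_of_nonneg hr0] using (hF r hnr).norm
  have hG : SquareSummable (PowerSeries.rescale (r : ℂ) F) := by
    refine ((hs.mul_of_nonneg hs (fun n => by positivity) fun n => by positivity).comp_injective
      (i := fun n : ℕ => (n, n)) fun a b h => congrArg Prod.fst h).congr fun n => ?_
    simp [abs_of_nonneg hr0, mul_comm, sq]
  obtain ⟨f, hf⟩ := hG.exists_taylor_eq
  let u : C(UnitAddCircle, ℂ) :=
    ⟨fun t => diskSum F (r * (t.toCircle : ℂ)), hF.continuous_circle hr0 hr1⟩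
  have hu : HasSum (fun n : ℕ => PowerSeries.coeff n (taylor f) • (fourier (n : ℤ) :
      C(UnitAddCircle, ℂ))) u := by
    have h1 : Summable fun n : ℕ => PowerSeries.coeff n (taylor f) • (fourier (n : ℤ) :
        C(UnitAddCircle, ℂ)) := by
      refine .of_norm (hs.congr fun n => ?_)
      rw [norm_smul, fourier_norm, hf]
      simp [abs_of_nonneg hr0, mul_comm]
    convert h1.hasSum
    ext t
    refine HasSum.unique ?_ (ContinuousMap.hasSum_apply h1.hasSum t)
    refine (hF (r * (t.toCircle : ℂ)) (norm_mul_toCircle_lt_one hr0 hr1 t)).hasSum.congr_fun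
      fun n => ?_
    simp [hf, mul_pow, toCircle_nsmul]
    ring
  have hfu : (f : L2) = ContinuousMap.toLp 2 circleMeasure ℂ u := by
    have h1 := (ContinuousMap.toLp (E := ℂ) 2 circleMeasure ℂ).hasSum hu
    refine HasSum.unique ?_ h1
    refine ((Nat.cast_injective (R := ℤ)).hasSum_iff ?_).2 (hasSum_fourier_series_L2 (f : L2))
      |>.congr_fun fun n => ?_
    · intro m hm
      have hm' := neg_of_notMem_range_natCast hm
      rw [f.2 m hm', zero_smul]
    · simp [taylor, fourierLp]
  have hnorm : ‖f‖ ^ 2 =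
      ∫ t : UnitAddCircle, ‖diskSum F (r * (t.toCircle : ℂ))‖ ^ 2 ∂circleMeasure := by
    have h1 := (hasSum_sq_fourierCoeff (f : L2)).unique <|
      ((Nat.cast_injective (R := ℤ)).hasSum_iff (by
        intro m hm
        have hm' := neg_of_notMem_range_natCast hm
        rw [f.2 m hm']
        simp)).1 ((hasSum_norm_sq f).congr_fun fun n => by simp [taylor])
    rw [← h1]
    refine integral_congr_ae ?_
    rw [hfu]
    filter_upwards [ContinuousMap.coeFn_toLp (p := 2) (𝕜 := ℂ) circleMeasure u] with t ht
    rw [ht]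
    rfl
  rw [← hnorm]
  refine (hasSum_norm_sq f).congr_fun fun n => ?_
  simp [hf, abs_of_nonneg hr0, mul_comm]

theorem SquareSummable.mul_of_bounded {B F : PowerSeries ℂ} (hF : SquareSummable F)
    (hB : ConvergesOnDisk B) {C : ℝ} (hC : ∀ z : 𝔻, ‖diskSum B z‖ ≤ C) :
    SquareSummable (B * F) := by
  have hC0 : 0 ≤ C := (norm_nonneg _).trans (hC 0)
  have hFd := hF.convergesOnDisk
  have key : ∀ N : ℕ, ∀ r : ℝ, 0 ≤ r → r < 1 →
      ∑ n ∈ Finset.range N, (‖PowerSeries.coeff n (B * F)‖ * r ^ n) ^ 2 ≤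
        C ^ 2 * ∑' n, ‖PowerSeries.coeff n F‖ ^ 2 := by
    intro N r hr0 hr1
    have h1 := (hB.mul hFd).hasSum_circle hr0 hr1
    have h2 := hFd.hasSum_circle hr0 hr1
    refine (h1.summable.sum_le_tsum _ fun n _ => by positivity).trans ?_
    rw [h1.tsum_eq]
    calc _ ≤ ∫ t : UnitAddCircle, C ^ 2 * ‖diskSum F (r * (t.toCircle : ℂ))‖ ^ 2
              ∂circleMeasure := by
          refine integral_mono ?_ ?_ fun t => ?_
          · exact (((hB.mul hFd).continuous_circle hr0 hr1).norm.pow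
              2).integrable_of_hasCompactSupport (HasCompactSupport.of_compactSpace _)
          · exact (((hFd.continuous_circle hr0 hr1).norm.pow 2).const_mul
              _).integrable_of_hasCompactSupport (HasCompactSupport.of_compactSpace _)
          · have hz := norm_mul_toCircle_lt_one hr0 hr1 t
            simp only [diskSum_mul hB hFd hz, norm_mul, mul_pow]
            gcongr
            exact hC (.mk _ hz)
      _ = C ^ 2 * ∑' n, (‖PowerSeries.coeff n F‖ * r ^ n) ^ 2 := by
          rw [integral_const_mul, h2.tsum_eq]
      _ ≤ _ := by
          refine mul_le_mul_of_nonneg_left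
            (Summable.tsum_le_tsum (fun n => ?_) h2.summable hF) (by positivity)
          gcongr
          exact mul_le_of_le_one_right (norm_nonneg _) (pow_le_one₀ hr0 hr1.le)
  refine summable_of_sum_range_le (c := C ^ 2 * ∑' n, ‖PowerSeries.coeff n F‖ ^ 2)
    (fun n => by positivity) fun N => ?_
  have hcont : Filter.Tendsto
      (fun r : ℝ => ∑ n ∈ Finset.range N, (‖PowerSeries.coeff n (B * F)‖ * r ^ n) ^ 2)
      (nhdsWithin 1 (Set.Iio 1))
      (nhds (∑ n ∈ Finset.range N, (‖PowerSeries.coeff n (B * F)‖ * 1 ^ n) ^ 2)) :=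
    ((by fun_prop : Continuous _).tendsto 1).mono_left nhdsWithin_le_nhds
  simp only [one_pow, mul_one] at hcont
  refine le_of_tendsto hcont ?_
  filter_upwards [Ioo_mem_nhdsLT zero_lt_one] with r hr
  exact key N r hr.1.le hr.2

/-! ### The reproducing kernel and the growth of Hardy functions -/

/-- The reproducing kernel of `H²` at the point `z` of the disk. -/
theorem exists_reproducingKernel {z : ℂ} (hz : ‖z‖ < 1) :
    ∃ k : H2, (∀ f : H2, inner ℂ k f = diskSum (taylor f) z) ∧ ‖k‖ ^ 2 = (1 - ‖z‖ ^ 2)⁻¹ := by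
  have hz2 : ‖z‖ ^ 2 < 1 := by nlinarith [norm_nonneg z]
  have hgeom := hasSum_geometric_of_lt_one (sq_nonneg ‖z‖) hz2
  have hK : SquareSummable (PowerSeries.mk fun n => starRingEnd ℂ z ^ n) := by
    refine hgeom.summable.congr fun n => ?_
    simp [← pow_mul, mul_comm]
  obtain ⟨k, hk⟩ := hK.exists_taylor_eq
  refine ⟨k, fun f => ?_, ?_⟩
  · refine (hasSum_inner k f).tsum_eq.symm.trans (tsum_congr fun n => ?_)
    simp [hk, mul_comm]
  · refine (hasSum_norm_sq k).unique (hgeom.congr_fun fun n => ?_)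
    simp [hk, ← pow_mul, mul_comm]

theorem SquareSummable.norm_diskSum_sq_le {F : PowerSeries ℂ} (hF : SquareSummable F) {z : ℂ}
    (hz : ‖z‖ < 1) :
    (1 - ‖z‖) * ‖diskSum F z‖ ^ 2 ≤ ∑' n, ‖PowerSeries.coeff n F‖ ^ 2 := by
  obtain ⟨f, rfl⟩ := hF.exists_taylor_eq
  obtain ⟨k, hk, hk2⟩ := exists_reproducingKernel hz
  rw [(hasSum_norm_sq f).tsum_eq, ← hk f]
  have hpos : 0 < 1 - ‖z‖ ^ 2 := by nlinarith [norm_nonneg z]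
  calc (1 - ‖z‖) * ‖(inner ℂ k f : ℂ)‖ ^ 2 ≤ (1 - ‖z‖ ^ 2) * (‖k‖ * ‖f‖) ^ 2 := by
        gcongr
        · nlinarith [norm_nonneg z]
        · exact norm_inner_le_norm k f
    _ = ‖f‖ ^ 2 := by
        rw [mul_pow, hk2, ← mul_assoc, mul_inv_cancel₀ hpos.ne', one_mul]

theorem norm_mul_circle {r : ℝ} (hr0 : 0 ≤ r) (ζ : Circle) : ‖(r * (ζ : ℂ))‖ = r := by
  rw [norm_mul, Circle.norm_coe, mul_one, Complex.norm_real, Real.norm_of_nonneg hr0]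

/-- A function in `H²` grows more slowly than `(1 - |z|) ^ (-1/2)` along each radius: the tail of
its Taylor series contributes an arbitrarily small constant, and a polynomial is bounded. -/
theorem SquareSummable.tendsto_radial {F : PowerSeries ℂ} (hF : SquareSummable F) (ζ : Circle) :
    Filter.Tendsto (fun r : ℝ => (1 - r) * ‖diskSum F (r * ζ)‖ ^ 2)
      (nhdsWithin 1 (Set.Iio 1)) (nhds 0) := by
  refine Metric.tendsto_nhds.2 fun ε hε => ?_
  obtain ⟨N, hN⟩ := ((Metric.tendsto_nhds.1
    (tendsto_sum_nat_add fun n => ‖PowerSeries.coeff n F‖ ^ 2)) (ε / 4) (by positivity)).exists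
  let p := PowerSeries.trunc N F
  let G : PowerSeries ℂ := PowerSeries.mk fun n => PowerSeries.coeff (n + N) F
  have hFG : F = PowerSeries.X ^ N * G + (p : PowerSeries ℂ) :=
    PowerSeries.eq_X_pow_mul_shift_add_trunc N F
  have hG : SquareSummable G := by
    refine ((summable_nat_add_iff N).2 hF).congr fun n => ?_
    simp [G]
  have hGε : ∑' n, ‖PowerSeries.coeff n G‖ ^ 2 < ε / 4 := by
    simpa [G] using (le_abs_self _).trans_lt hN
  have hp : Filter.Tendsto (fun r : ℝ => (1 - r) * ‖p.eval (r * (ζ : ℂ))‖ ^ 2)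
      (nhdsWithin 1 (Set.Iio 1)) (nhds ((1 - 1) * ‖p.eval (((1 : ℝ) : ℂ) * (ζ : ℂ))‖ ^ 2)) :=
    ((by fun_prop : Continuous fun r : ℝ =>
      (1 - r) * ‖p.eval (r * (ζ : ℂ))‖ ^ 2).tendsto 1).mono_left nhdsWithin_le_nhds
  rw [sub_self, zero_mul] at hp
  filter_upwards [Ioo_mem_nhdsLT zero_lt_one,
    Metric.tendsto_nhds.1 hp (ε / 4) (by positivity)] with r hr hpr
  have hnorm := norm_mul_circle hr.1.le ζ
  have hz : ‖(r * (ζ : ℂ))‖ < 1 := hnorm.trans_lt hr.2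
  have hsum : diskSum F (r * ζ) = (r * ζ) ^ N * diskSum G (r * ζ) + p.eval (r * (ζ : ℂ)) := by
    have hX := convergesOnDisk_coe (Polynomial.X ^ N)
    have hX' := diskSum_coe (Polynomial.X ^ N) (r * (ζ : ℂ))
    rw [Polynomial.coe_pow, Polynomial.coe_X] at hX hX'
    conv_lhs => rw [hFG]
    rw [diskSum_add (hX.mul hG.convergesOnDisk) (convergesOnDisk_coe p) hz,
      diskSum_mul hX hG.convergesOnDisk hz, hX', diskSum_coe]
    simp
  have h1r : 0 < 1 - r := sub_pos.2 hr.2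
  have hle : ‖diskSum F (r * ζ)‖ ≤ ‖diskSum G (r * ζ)‖ + ‖p.eval (r * (ζ : ℂ))‖ := by
    rw [hsum]
    refine (norm_add_le _ _).trans (add_le_add_left ?_ _)
    rw [norm_mul, norm_pow]
    exact mul_le_of_le_one_left (norm_nonneg _) (pow_le_one₀ (norm_nonneg _) hz.le)
  have hGr := hG.norm_diskSum_sq_le hz
  rw [hnorm] at hGr
  rw [Real.dist_0_eq_abs, abs_of_nonneg (by positivity)] at hpr ⊢
  have hsq : ‖diskSum F (r * ζ)‖ ^ 2 ≤
      2 * ‖diskSum G (r * ζ)‖ ^ 2 + 2 * ‖p.eval (r * (ζ : ℂ))‖ ^ 2 := by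
    nlinarith [norm_nonneg (diskSum F (r * ζ)),
      sq_nonneg (‖diskSum G (r * ζ)‖ - ‖p.eval (r * (ζ : ℂ))‖)]
  nlinarith [mul_le_mul_of_nonneg_left hsq h1r.le]

/-! ### Division by polynomials with zeros on the circle -/

/-- If `p / ∏ (X - ζ j)`, with all `ζ j` on the unit circle, is `o(1 / (1 - |z|))` along each
radius, then it is a polynomial: a pole on the circle would force faster growth. -/
theorem prod_X_sub_C_dvd_of_tendsto {N : ℕ} (ζ : Fin N → Circle) (p : Polynomial ℂ) (F : ℂ → ℂ)
    (hF : ∀ z : ℂ, ‖z‖ < 1 →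
      p.eval z = (∏ j, (Polynomial.X - Polynomial.C (ζ j : ℂ))).eval z * F z)
    (hg : ∀ ξ : Circle, Filter.Tendsto (fun r : ℝ => (1 - r) * ‖F (r * ξ)‖)
      (nhdsWithin 1 (Set.Iio 1)) (nhds 0)) :
    ∏ j, (Polynomial.X - Polynomial.C (ζ j : ℂ)) ∣ p := by
  induction N generalizing p with
  | zero => simp
  | succ N ih =>
    rw [Fin.prod_univ_succ] at hF ⊢
    set b := ∏ j : Fin N, (Polynomial.X - Polynomial.C (ζ j.succ : ℂ)) with hb
    have hcont : ∀ q : Polynomial ℂ, Filter.Tendsto (fun r : ℝ => ‖q.eval (r * (ζ 0 : ℂ))‖)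
        (nhdsWithin 1 (Set.Iio 1)) (nhds ‖q.eval (((1 : ℝ) : ℂ) * (ζ 0 : ℂ))‖) := fun q =>
      ((by fun_prop : Continuous fun r : ℝ => ‖q.eval (r * (ζ 0 : ℂ))‖).tendsto 1).mono_left
        nhdsWithin_le_nhds
    have hroot : p.eval (ζ 0 : ℂ) = 0 := by
      have h1 := (hg (ζ 0)).mul (hcont b)
      have h2 := tendsto_nhds_unique (hcont p) (h1.congr' ?_)
      · simpa using h2
      · filter_upwards [Ioo_mem_nhdsLT zero_lt_one] with r hr
        have hnorm := norm_mul_circle hr.1.le (ζ 0)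
        rw [hF _ (hnorm.trans_lt hr.2), Polynomial.eval_mul, norm_mul, norm_mul]
        have h3 : ‖(Polynomial.X - Polynomial.C (ζ 0 : ℂ)).eval (r * (ζ 0 : ℂ))‖ = 1 - r := by
          have h4 : (r * ζ 0 - ζ 0 : ℂ) = -(((1 - r : ℝ) : ℂ) * ζ 0) := by
            push_cast
            ring
          rw [Polynomial.eval_sub, Polynomial.eval_X, Polynomial.eval_C, h4, norm_neg,
            norm_mul_circle (sub_nonneg.2 hr.2.le)]
        rw [h3]
        ring
    obtain ⟨q, rfl⟩ := Polynomial.dvd_iff_isRoot.2 hroot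
    refine mul_dvd_mul_left _ (ih (fun j => ζ j.succ) q fun z hz => ?_)
    have hne : z - ζ 0 ≠ 0 := by
      intro h
      rw [sub_eq_zero.1 h, Circle.norm_coe] at hz
      exact lt_irrefl _ hz
    have h5 := hF z hz
    simp only [Polynomial.eval_mul, Polynomial.eval_sub, Polynomial.eval_X, Polynomial.eval_C,
      mul_assoc] at h5
    exact mul_left_cancel₀ hne h5

theorem dvd_of_tendsto {a p : Polynomial ℂ} (ha : a ∈ classA) (F : ℂ → ℂ)
    (hF : ∀ z : ℂ, ‖z‖ < 1 → p.eval z = a.eval z * F z)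
    (hg : ∀ ξ : Circle, Filter.Tendsto (fun r : ℝ => (1 - r) * ‖F (r * ξ)‖)
      (nhdsWithin 1 (Set.Iio 1)) (nhds 0)) : a ∣ p := by
  obtain ⟨N, ζ, rfl⟩ := ha
  exact prod_X_sub_C_dvd_of_tendsto ζ p F hF hg

theorem eval_ne_zero_of_mem_classA {a : Polynomial ℂ} (ha : a ∈ classA) {z : ℂ} (hz : ‖z‖ < 1) :
    a.eval z ≠ 0 := by
  obtain ⟨N, ζ, rfl⟩ := ha
  rw [Polynomial.eval_prod, Finset.prod_ne_zero_iff]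
  intro j _ h
  rw [Polynomial.eval_sub, Polynomial.eval_X, Polynomial.eval_C, sub_eq_zero] at h
  rw [h, Circle.norm_coe] at hz
  exact lt_irrefl _ hz

theorem monic_of_mem_classA {a : Polynomial ℂ} (ha : a ∈ classA) : a.Monic := by
  obtain ⟨N, ζ, rfl⟩ := ha
  exact Polynomial.monic_prod_X_sub_C _ _

theorem dvd_of_bounded_quotient {a₁ a₂ : Polynomial ℂ} (ha₂ : a₂ ∈ classA)
    (hh : quotient a₁ a₂ ∈ HInf) : a₂ ∣ a₁ := by
  obtain ⟨-, C, hC⟩ := hh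
  refine dvd_of_tendsto ha₂ (fun z => a₁.eval z / a₂.eval z)
    (fun z hz => (mul_div_cancel₀ _ (eval_ne_zero_of_mem_classA ha₂ hz)).symm) fun ξ => ?_
  have hlim : Filter.Tendsto (fun r : ℝ => (1 - r) * C) (nhdsWithin 1 (Set.Iio 1)) (nhds 0) := by
    have h := ((by fun_prop : Continuous fun r : ℝ => (1 - r) * C).tendsto 1).mono_left
      (nhdsWithin_le_nhds (s := Set.Iio 1))
    rwa [sub_self, zero_mul] at h
  refine squeeze_zero' ?_ ?_ hlim
  · filter_upwards [Ioo_mem_nhdsLT zero_lt_one] with r hr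
    exact mul_nonneg (sub_nonneg.2 hr.2.le) (norm_nonneg _)
  · filter_upwards [Ioo_mem_nhdsLT zero_lt_one] with r hr
    exact mul_le_mul_of_nonneg_left
      (hC (.mk _ ((norm_mul_circle hr.1.le ξ).trans_lt hr.2))) (sub_nonneg.2 hr.2.le)

/-! ### Multipliers of the Hardy space are bounded -/

theorem toDisk_eq_inner {z : 𝔻} {k : H2} (hk : ∀ f : H2, inner ℂ k f = diskSum (taylor f) z)
    (f : H2) : toDisk f z = inner ℂ k f := by
  rw [toDisk_eq_diskSum, hk]

theorem toDisk_injective : Function.Injective toDisk := by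
  intro f g h
  refine taylor_injective ((squareSummable_taylor f).convergesOnDisk.ext
    (squareSummable_taylor g).convergesOnDisk fun z => ?_)
  rw [← toDisk_eq_diskSum, ← toDisk_eq_diskSum, h]

/-- A function that multiplies `H²` into itself is bounded. Multiplication by it is a bounded
operator `M` by the closed graph theorem, and `ψ z ‖k‖² = ⟪k, M k⟫` for the reproducing kernel `k`
at `z`. -/
theorem bounded_of_mul_mem {ψ : 𝔻 → ℂ} (hψ : ∀ f : H2, ψ * toDisk f ∈ Set.range toDisk) :
    ∃ C : ℝ, ∀ z : 𝔻, ‖ψ z‖ ≤ C := by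
  choose m hm using hψ
  have hm' : ∀ f z, toDisk (m f) z = ψ z * toDisk f z := fun f z => congrFun (hm f) z
  choose k hk hk2 using fun z : 𝔻 => exists_reproducingKernel z.norm_lt_one
  have hev : ∀ f z, toDisk f z = inner ℂ (k z) f := fun f z => toDisk_eq_inner (hk z) f
  let M : H2 →ₗ[ℂ] H2 :=
    { toFun := m
      map_add' := fun f g => toDisk_injective <| funext fun z => by
        rw [hm', hev, hev, inner_add_right, inner_add_right, mul_add, ← hev, ← hev, ← hev, ← hev,
          hm', hm']
      map_smul' := fun c f => toDisk_injective <| funext fun z => by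
        rw [hm', hev, hev, RingHom.id_apply, inner_smul_right, inner_smul_right, ← hev, ← hev, hm']
        ring }
  have hM : Continuous M := by
    refine M.continuous_of_seq_closed_graph fun u x y hu hy => ?_
    refine toDisk_injective <| funext fun z => ?_
    have h1 : Filter.Tendsto (fun n => toDisk (M (u n)) z) Filter.atTop (nhds (toDisk y z)) := by
      simp only [hev]
      exact ((innerSL ℂ (k z)).continuous.tendsto y).comp hy
    have h2 : Filter.Tendsto (fun n => ψ z * toDisk (u n) z) Filter.atTop
        (nhds (ψ z * toDisk x z)) := by
      simp only [hev]
      exact (((innerSL ℂ (k z)).continuous.tendsto x).comp hu).const_mul _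
    rw [show toDisk (M x) z = ψ z * toDisk x z from hm' x z]
    exact tendsto_nhds_unique h1 (h2.congr fun n => (hm' (u n) z).symm)
  let M' : H2 →L[ℂ] H2 := ⟨M, hM⟩
  refine ⟨‖M'‖, fun z => ?_⟩
  have hpos : 0 < ‖k z‖ ^ 2 := by
    rw [hk2, inv_pos, sub_pos]
    exact z.sq_norm_lt_one
  have h3 : (inner ℂ (k z) (M' (k z)) : ℂ) = ψ z * (‖k z‖ ^ 2 : ℝ) := by
    rw [← hev]
    refine (hm' (k z) z).trans ?_
    have h4 := inner_self_eq_norm_sq_to_K (𝕜 := ℂ) (k z)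
    rw [hev, h4]
    norm_cast
  refine le_of_mul_le_mul_right ?_ hpos
  calc ‖ψ z‖ * ‖k z‖ ^ 2 = ‖(inner ℂ (k z) (M' (k z)) : ℂ)‖ := by
        rw [h3, norm_mul, Complex.norm_real, Real.norm_of_nonneg hpos.le]
    _ ≤ ‖k z‖ * (‖M'‖ * ‖k z‖) :=
        (norm_inner_le_norm (𝕜 := ℂ) (k z) (M' (k z))).trans
          (mul_le_mul_of_nonneg_left (M'.le_opNorm _) (norm_nonneg _))
    _ = ‖M'‖ * ‖k z‖ ^ 2 := by ring

/-! ### The range of a co-analytic Toeplitz operator -/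

/-- On the unit circle, `conj (a z)` and `a z` differ by a constant and the factor `z ^ (-N)`,
where `N` is the degree of `a`. -/
theorem exists_conj_eval_eq {a : Polynomial ℂ} (ha : a ∈ classA) :
    ∃ c : ℂ, c ≠ 0 ∧ ∀ z : Circle,
      starRingEnd ℂ (a.eval (z : ℂ)) = c * ((z : ℂ) ^ a.natDegree)⁻¹ * a.eval (z : ℂ) := by
  obtain ⟨N, ζ, rfl⟩ := ha
  refine ⟨∏ j, (-(ζ j : ℂ)⁻¹), Finset.prod_ne_zero_iff.2 fun j _ =>
    neg_ne_zero.2 (inv_ne_zero (ζ j).coe_ne_zero), fun z => ?_⟩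
  have hdeg : (∏ j, (Polynomial.X - Polynomial.C (ζ j : ℂ))).natDegree = N := by
    rw [Polynomial.natDegree_prod_of_monic _ _ fun j _ => Polynomial.monic_X_sub_C _]
    simp
  have hpow : ((z : ℂ) ^ N)⁻¹ = ∏ _j : Fin N, (z : ℂ)⁻¹ := by simp
  rw [hdeg, Polynomial.eval_prod, map_prod, hpow, ← Finset.prod_mul_distrib,
    ← Finset.prod_mul_distrib]
  refine Finset.prod_congr rfl fun j _ => ?_
  simp only [Polynomial.eval_sub, Polynomial.eval_X, Polynomial.eval_C, map_sub,
    ← Circle.coe_inv_eq_conj, Circle.coe_inv]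
  have h1 := z.coe_ne_zero
  have h2 := (ζ j).coe_ne_zero
  field_simp
  ring

theorem coeff_taylor_toeplitz (ψ : LInf) (f : H2) (n : ℕ) :
    PowerSeries.coeff n (taylor (toeplitz ψ f)) = fourierCoeff (ψ • (f : L2) : L2) (n : ℤ) := by
  have he : (fourierBasis (T := 1) (n : ℤ) : L2) ∈ H2 := by
    intro m hm
    have hne : (n : ℤ) ≠ m := by omega
    rw [← fourierBasis_repr, HilbertBasis.repr_apply_apply]
    exact fourierBasis.orthonormal.2 hne.symm
  rw [coeff_taylor, ← fourierBasis_repr, HilbertBasis.repr_apply_apply,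
    HilbertBasis.repr_apply_apply]
  exact Submodule.inner_orthogonalProjectionOnto_eq_of_mem_left (⟨_, he⟩ : H2) _

theorem fourierCoeff_fourier_mul (f : UnitAddCircle → ℂ) (m n : ℤ) :
    fourierCoeff (fun t => fourier m t * f t) n = fourierCoeff f (n - m) := by
  unfold fourierCoeff
  refine integral_congr_ae (Filter.Eventually.of_forall fun t => ?_)
  simp only [smul_eq_mul]
  rw [← mul_assoc, ← fourier_add, neg_sub, sub_eq_neg_add]

/-- Up to a constant, the Taylor coefficients of `P (conj a • f)` are those of `a * f` shifted by
the degree `N` of `a`, because `conj a` is a constant multiple of `z ^ (-N) * a` on the circle. -/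
theorem exists_coeff_taylor_toeplitz_conjSymbol {a : Polynomial ℂ} (ha : a ∈ classA) :
    ∃ c : ℂ, c ≠ 0 ∧ ∀ (f : H2) (n : ℕ),
      PowerSeries.coeff n (taylor (toeplitz (conjSymbol a) f)) =
        c * PowerSeries.coeff (n + a.natDegree) ((a : PowerSeries ℂ) * taylor f) := by
  obtain ⟨c, hc, hconj⟩ := exists_conj_eval_eq ha
  refine ⟨c, hc, fun f n => ?_⟩
  set N := a.natDegree
  have hae : ((conjSymbol a • (f : L2) : L2) : UnitAddCircle → ℂ) =ᵐ[circleMeasure]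
      ∑ k ∈ Finset.range (n + N + 1),
        fun t => (c * a.coeff k) * (fourier ((k : ℤ) - N) t * (f : L2) t) := by
    filter_upwards [Lp.coeFn_lpSMul (r := 2) (conjSymbol a) (f : L2),
      ContinuousMap.coeFn_toLp (p := ⊤) (𝕜 := ℂ) circleMeasure
        ⟨fun t : UnitAddCircle => starRingEnd ℂ (a.eval (t.toCircle : ℂ)), by fun_prop⟩]
      with t h1 h2
    have h3 : (conjSymbol a : UnitAddCircle → ℂ) t =
        starRingEnd ℂ (a.eval (t.toCircle : ℂ)) := h2
    rw [h1, Pi.smul_apply', h3, hconj, smul_eq_mul, Finset.sum_apply,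
      Polynomial.eval_eq_sum_range' (n := n + N + 1) (by omega), Finset.mul_sum, Finset.sum_mul]
    refine Finset.sum_congr rfl fun k _ => ?_
    have h4 : (fourier ((k : ℤ) - N) t : ℂ) =
        (t.toCircle : ℂ) ^ k * ((t.toCircle : ℂ) ^ N)⁻¹ := by
      rw [fourier_apply, toCircle_zsmul, Circle.coe_zpow, zpow_sub₀ (Circle.coe_ne_zero _),
        zpow_natCast, zpow_natCast, div_eq_mul_inv]
    rw [h4]
    ring
  have hint : Integrable ((f : L2) : UnitAddCircle → ℂ) circleMeasure :=
    (Lp.memLp (f : L2)).integrable (by norm_num)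
  rw [coeff_taylor_toeplitz, fourierCoeff_congr_ae hae, fourierCoeff.sum _ _ fun k _ =>
      Integrable.const_mul (by simpa using hint.fourier_smul ((k : ℤ) - N)) _,
    PowerSeries.coeff_mul,
    Finset.Nat.sum_antidiagonal_eq_sum_range_succ_mk, Finset.mul_sum, Finset.sum_apply]
  refine Finset.sum_congr rfl fun k hk => ?_
  have hk' : k ≤ n + N := Nat.lt_succ_iff.1 (Finset.mem_range.1 hk)
  rw [fourierCoeff.const_mul, fourierCoeff_fourier_mul, Polynomial.coeff_coe, taylor,
    PowerSeries.coeff_mk, mul_assoc]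
  congr 3
  push_cast [Nat.cast_sub hk']
  ring

/-- A power series whose coefficients are those of `a * F` shifted by `N` lies in `a H² + ℂ[X]`:
the polynomial cut off by the shift is a combination of the coprime polynomials `a` and `X ^ N`. -/
theorem exists_eq_mul_add_of_coeff_eq {a : Polynomial ℂ} (ha : a.coeff 0 ≠ 0) {N : ℕ} {c : ℂ}
    {F Φ : PowerSeries ℂ} (hF : SquareSummable F)
    (h : ∀ n, PowerSeries.coeff n Φ = c * PowerSeries.coeff (n + N) ((a : PowerSeries ℂ) * F)) :
    ∃ W : PowerSeries ℂ, SquareSummable W ∧ ∃ p : Polynomial ℂ,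
      Φ = (a : PowerSeries ℂ) * W + (p : PowerSeries ℂ) := by
  let A : PowerSeries ℂ := PowerSeries.C c * ((a : PowerSeries ℂ) * F)
  obtain ⟨q, hshift⟩ : ∃ q : Polynomial ℂ, A = PowerSeries.X ^ N * Φ + (q : PowerSeries ℂ) := by
    have h1 : Φ = PowerSeries.mk fun i => PowerSeries.coeff (i + N) A := by
      ext n
      rw [h, PowerSeries.coeff_mk, PowerSeries.coeff_C_mul]
    rw [h1]
    exact ⟨_, PowerSeries.eq_X_pow_mul_shift_add_trunc N A⟩
  have hcop : IsCoprime a (Polynomial.X ^ N) :=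
    ((Polynomial.irreducible_X.coprime_iff_not_dvd).2 fun h =>
      ha (Polynomial.X_dvd_iff.1 h)).symm.pow_right
  obtain ⟨s, t, hst⟩ := hcop
  obtain ⟨u, v, huv⟩ : ∃ u v : Polynomial ℂ, q = a * u + Polynomial.X ^ N * v :=
    ⟨q * s, q * t, by linear_combination -q * hst⟩
  have hq : (q : PowerSeries ℂ) = (a : PowerSeries ℂ) * (u : PowerSeries ℂ) +
      PowerSeries.X ^ N * (v : PowerSeries ℂ) := by
    rw [huv]
    simp
  have heq : PowerSeries.X ^ N * (Φ + (v : PowerSeries ℂ)) =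
      (a : PowerSeries ℂ) * (PowerSeries.C c * F - (u : PowerSeries ℂ)) := by
    have h1 : A = (a : PowerSeries ℂ) * (PowerSeries.C c * F) := by ring
    linear_combination h1 - hshift - hq
  have hunit : IsUnit (a : PowerSeries ℂ) := by
    rw [PowerSeries.isUnit_iff_constantCoeff]
    simpa using ha
  obtain ⟨W, hW⟩ : PowerSeries.X ^ N ∣ PowerSeries.C c * F - (u : PowerSeries ℂ) :=
    (hunit.dvd_mul_left).1 ⟨_, heq.symm⟩
  refine ⟨W, ?_, -v, ?_⟩
  · rw [← squareSummable_X_pow_mul N, ← hW, sub_eq_add_neg, ← Polynomial.coe_neg]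
    exact (hF.C_mul c).add (squareSummable_coe _)
  · rw [hW, mul_left_comm] at heq
    have h1 := mul_left_cancel₀ (pow_ne_zero N PowerSeries.X_ne_zero) heq
    rw [Polynomial.coe_neg]
    linear_combination h1

/-- Conversely, every element of `a H² + ℂ[X]` arises from some `a * F` by shifting by the degree
of `a`: division of `X ^ N * p` by `a` leaves a remainder that the shift annihilates. -/
theorem exists_coeff_eq_of_eq_mul_add {a : Polynomial ℂ} (ha : a.Monic) {c : ℂ} (hc : c ≠ 0)
    {G : PowerSeries ℂ} (hG : SquareSummable G) (p : Polynomial ℂ) :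
    ∃ F : PowerSeries ℂ, SquareSummable F ∧ ∀ n,
      PowerSeries.coeff n ((a : PowerSeries ℂ) * G + (p : PowerSeries ℂ)) =
        c * PowerSeries.coeff (n + a.natDegree) ((a : PowerSeries ℂ) * F) := by
  set N := a.natDegree with hN
  set q := (Polynomial.X ^ N * p) %ₘ a with hq
  set u := (Polynomial.X ^ N * p) /ₘ a with hu
  have hqu : q + a * u = Polynomial.X ^ N * p := Polynomial.modByMonic_add_div _ a
  have hqu' := congrArg (fun r : Polynomial ℂ => (r : PowerSeries ℂ)) hqu
  simp only [Polynomial.coe_add, Polynomial.coe_mul, Polynomial.coe_pow, Polynomial.coe_X] at hqu'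
  refine ⟨PowerSeries.C c⁻¹ * (PowerSeries.X ^ N * G + (u : PowerSeries ℂ)),
    (((squareSummable_X_pow_mul N).2 hG).add (squareSummable_coe u)).C_mul _, fun n => ?_⟩
  have h2 : PowerSeries.C c * PowerSeries.C c⁻¹ = (1 : PowerSeries ℂ) := by
    rw [← map_mul, mul_inv_cancel₀ hc, map_one]
  have h1 : PowerSeries.X ^ N * ((a : PowerSeries ℂ) * G + (p : PowerSeries ℂ)) =
      PowerSeries.C c * ((a : PowerSeries ℂ) *
        (PowerSeries.C c⁻¹ * (PowerSeries.X ^ N * G + (u : PowerSeries ℂ)))) +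
        (q : PowerSeries ℂ) := by
    linear_combination -hqu' -
      (a : PowerSeries ℂ) * (PowerSeries.X ^ N * G + (u : PowerSeries ℂ)) * h2
  have hqN : q.coeff (n + N) = 0 := by
    refine Polynomial.coeff_eq_zero_of_degree_lt
      ((Polynomial.degree_modByMonic_lt _ ha).trans_le ?_)
    exact Polynomial.degree_le_natDegree.trans (by exact_mod_cast Nat.le_add_left _ _)
  rw [← PowerSeries.coeff_C_mul, ← PowerSeries.coeff_X_pow_mul _ N, h1, map_add,
    Polynomial.coeff_coe, hqN, add_zero]

/-- The range of the Toeplitz operator with symbol `conj a` is `a H² + ℂ[X]`. -/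
theorem mem_rangeSpace_iff {a : Polynomial ℂ} (ha : a ∈ classA) {φ : 𝔻 → ℂ} :
    φ ∈ rangeSpace a ↔ ∃ G : PowerSeries ℂ, SquareSummable G ∧ ∃ p : Polynomial ℂ,
      ∀ z : 𝔻, φ z = a.eval (z : ℂ) * diskSum G z + p.eval (z : ℂ) := by
  obtain ⟨c, hc, hT⟩ := exists_coeff_taylor_toeplitz_conjSymbol ha
  constructor
  · rintro ⟨f, rfl⟩
    have ha0 : a.coeff 0 ≠ 0 := by
      rw [Polynomial.coeff_zero_eq_eval_zero]
      exact eval_ne_zero_of_mem_classA ha (by simp)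
    obtain ⟨W, hW, p, h⟩ := exists_eq_mul_add_of_coeff_eq ha0 (squareSummable_taylor f) (hT f)
    exact ⟨W, hW, p, fun z => by rw [toDisk_eq_diskSum, h, hW.diskSum_coe_mul_add]⟩
  · rintro ⟨G, hG, p, hφ⟩
    obtain ⟨F, hF, h⟩ := exists_coeff_eq_of_eq_mul_add (monic_of_mem_classA ha) hc hG p
    obtain ⟨f, rfl⟩ := hF.exists_taylor_eq
    refine ⟨f, funext fun z => ?_⟩
    have h' : taylor (toeplitz (conjSymbol a) f) = (a : PowerSeries ℂ) * G + (p : PowerSeries ℂ) :=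
      PowerSeries.ext fun n => by rw [hT, h]
    rw [toDisk_eq_diskSum, h', hG.diskSum_coe_mul_add, hφ]

/-! ### Multipliers between ranges -/

theorem mem_rangeSpace_of_mem_multipliers {a₁ a₂ : Polynomial ℂ} (ha₁ : a₁ ∈ classA)
    {φ : 𝔻 → ℂ} (hφ : φ ∈ multipliers a₁ a₂) : φ ∈ rangeSpace a₂ := by
  have h1 : (1 : 𝔻 → ℂ) ∈ rangeSpace a₁ :=
    (mem_rangeSpace_iff ha₁).2 ⟨((0 : Polynomial ℂ) : PowerSeries ℂ), squareSummable_coe 0, 1,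
      fun z => by rw [diskSum_coe]; simp⟩
  simpa using hφ.2 1 h1

/-- If `φ` multiplies the range for `a₂ * b` into the range for `a₂`, then `b φ` multiplies `H²`
into itself. For `f ∈ H²` one has `a₂ b φ f = a₂ g + p` with `g ∈ H²` and a polynomial `p`, so that
`p / a₂` is the difference of the `H¹` function `b φ f` and `g`; such a function has no poles on
the circle, so `a₂ ∣ p`. -/
theorem mul_toDisk_mem_range {a₂ b : Polynomial ℂ} (ha₁ : a₂ * b ∈ classA) (ha₂ : a₂ ∈ classA)
    {φ : 𝔻 → ℂ} (hφ : φ ∈ multipliers (a₂ * b) a₂) (f : H2) :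
    (fun z : 𝔻 => b.eval (z : ℂ) * φ z) * toDisk f ∈ Set.range toDisk := by
  obtain ⟨K, hK, q, hKq⟩ := (mem_rangeSpace_iff ha₂).1 (mem_rangeSpace_of_mem_multipliers ha₁ hφ)
  have hΦ : SquareSummable ((a₂ : PowerSeries ℂ) * K + (q : PowerSeries ℂ)) :=
    (hK.coe_mul a₂).add (squareSummable_coe q)
  set Φ := (a₂ : PowerSeries ℂ) * K + (q : PowerSeries ℂ)
  have hφΦ : ∀ z : 𝔻, φ z = diskSum Φ z := fun z => by
    rw [hKq, hK.diskSum_coe_mul_add]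
  have hf := squareSummable_taylor f
  have hbf := hf.coe_mul b
  have hbf_eval : ∀ z : ℂ, ‖z‖ < 1 → diskSum ((b : PowerSeries ℂ) * taylor f) z =
      b.eval z * diskSum (taylor f) z := fun z hz => by
    rw [diskSum_mul (convergesOnDisk_coe b) hf.convergesOnDisk hz, diskSum_coe]
  have hmem : (fun z : 𝔻 => (a₂ * b).eval (z : ℂ) * diskSum (taylor f) z) ∈
      rangeSpace (a₂ * b) :=
    (mem_rangeSpace_iff ha₁).2 ⟨taylor f, hf, 0, fun z => by simp⟩
  obtain ⟨G, hG, p, hGp⟩ := (mem_rangeSpace_iff ha₂).1 (hφ.2 _ hmem)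
  have hp : ∀ z : ℂ, ‖z‖ < 1 → p.eval z =
      a₂.eval z * (diskSum ((b : PowerSeries ℂ) * taylor f) z * diskSum Φ z - diskSum G z) := by
    intro z hz
    have h1 := hGp (.mk z hz)
    rw [Pi.mul_apply, hφΦ, Complex.UnitDisc.coe_mk, Polynomial.eval_mul] at h1
    rw [hbf_eval z hz]
    linear_combination -h1
  obtain ⟨s, rfl⟩ : a₂ ∣ p := by
    refine dvd_of_tendsto ha₂ _ hp fun ξ => ?_
    -- By `2 x y ≤ x ^ 2 + y ^ 2`, the product of two `H²` functions is `o(1 / (1 - |z|))`. The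
    -- summand for the constant `1` is there because `‖G‖ ≤ ‖G‖ ^ 2 + 1`.
    have hlim := ((hbf.tendsto_radial ξ).add (hΦ.tendsto_radial ξ)).add
      ((hG.tendsto_radial ξ).add ((squareSummable_coe 1).tendsto_radial ξ))
    simp only [add_zero] at hlim
    refine squeeze_zero' ?_ ?_ hlim
    · filter_upwards [Ioo_mem_nhdsLT zero_lt_one] with r hr
      exact mul_nonneg (sub_nonneg.2 hr.2.le) (norm_nonneg _)
    · filter_upwards [Ioo_mem_nhdsLT zero_lt_one] with r hr
      rw [← mul_add, ← mul_add, ← mul_add, diskSum_coe, Polynomial.eval_one, norm_one]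
      refine mul_le_mul_of_nonneg_left ((norm_sub_le _ _).trans ?_) (sub_nonneg.2 hr.2.le)
      rw [norm_mul]
      nlinarith [sq_nonneg (‖diskSum ((b : PowerSeries ℂ) * taylor f) (r * ξ)‖ -
        ‖diskSum Φ (r * ξ)‖), sq_nonneg (‖diskSum ((b : PowerSeries ℂ) * taylor f) (r * ξ)‖ +
        ‖diskSum Φ (r * ξ)‖), sq_nonneg (‖diskSum G (r * ξ)‖ - 1)]
  refine mem_range_toDisk.2 ⟨G + (s : PowerSeries ℂ), hG.add (squareSummable_coe s), fun z => ?_⟩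
  rw [diskSum_add hG.convergesOnDisk (convergesOnDisk_coe s) z.norm_lt_one, diskSum_coe]
  have h1 := hp z z.norm_lt_one
  rw [Polynomial.eval_mul, hbf_eval z z.norm_lt_one] at h1
  have h2 := mul_left_cancel₀ (eval_ne_zero_of_mem_classA ha₂ z.norm_lt_one) h1
  rw [Pi.mul_apply, toDisk_eq_diskSum, hφΦ]
  linear_combination -h2

/-- If `φ` lies in the range for `a₂` and `b φ` is bounded, then `φ` multiplies the range for
`a₂ * b` into the range for `a₂`: on `a₂ b H²` because `H^∞ H² ⊆ H²`, and on polynomials because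
the range for `a₂`, being `a₂ H² + ℂ[X]`, is a module over the polynomials. -/
theorem mem_multipliers_of_bounded {a₂ b : Polynomial ℂ} (ha₁ : a₂ * b ∈ classA)
    (ha₂ : a₂ ∈ classA) {φ : 𝔻 → ℂ} (hφ : φ ∈ rangeSpace a₂)
    (hb : (fun z : 𝔻 => b.eval (z : ℂ) * φ z) ∈ HInf) : φ ∈ multipliers (a₂ * b) a₂ := by
  obtain ⟨K, hK, q, hKq⟩ := (mem_rangeSpace_iff ha₂).1 hφ
  obtain ⟨hB, C, hC⟩ := hb
  obtain ⟨B, hB, hBφ⟩ := isAnalytic_iff.1 hB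
  refine ⟨isAnalytic_iff.2 ⟨(a₂ : PowerSeries ℂ) * K + (q : PowerSeries ℂ),
    ((hK.coe_mul a₂).add (squareSummable_coe q)).convergesOnDisk, fun z => ?_⟩, fun f hf => ?_⟩
  · rw [hKq, hK.diskSum_coe_mul_add]
  · obtain ⟨G, hG, p, hGp⟩ := (mem_rangeSpace_iff ha₁).1 hf
    have hBG : SquareSummable (B * G) := hG.mul_of_bounded hB (C := C) fun z => by
      rw [← hBφ]
      exact hC z
    refine (mem_rangeSpace_iff ha₂).2 ⟨B * G + (p : PowerSeries ℂ) * K, hBG.add (hK.coe_mul p),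
      q * p, fun z => ?_⟩
    have hz := z.norm_lt_one
    rw [Pi.mul_apply, hGp, diskSum_add hBG.convergesOnDisk (hK.coe_mul p).convergesOnDisk hz,
      diskSum_mul hB hG.convergesOnDisk hz, diskSum_mul (convergesOnDisk_coe p)
      hK.convergesOnDisk hz, diskSum_coe, ← hBφ, Polynomial.eval_mul, Polynomial.eval_mul]
    linear_combination (p.eval (z : ℂ)) * hKq z

end CoanalyticToeplitz

open CoanalyticToeplitz in
theorem theorem1p1 (a₁ a₂ : Polynomial ℂ)
    (ha₁ : a₁ ∈ CoanalyticToeplitz.classA) (ha₂ : a₂ ∈ CoanalyticToeplitz.classA)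
    (hh : CoanalyticToeplitz.quotient a₁ a₂ ∈ CoanalyticToeplitz.HInf) :
    CoanalyticToeplitz.multipliers a₁ a₂ =
      {φ | φ ∈ CoanalyticToeplitz.rangeSpace a₂ ∧
        CoanalyticToeplitz.quotient a₁ a₂ * φ ∈ CoanalyticToeplitz.HInf} := by
  obtain ⟨b, rfl⟩ := dvd_of_bounded_quotient ha₂ hh
  have hquot : ∀ φ : 𝔻 → ℂ,
      quotient (a₂ * b) a₂ * φ = fun z : 𝔻 => b.eval (z : ℂ) * φ z := by
    intro φ
    funext z
    rw [Pi.mul_apply, quotient, Polynomial.eval_mul,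
      mul_div_cancel_left₀ _ (eval_ne_zero_of_mem_classA ha₂ z.norm_lt_one)]
  ext φ
  rw [Set.mem_ofPred_eq, hquot]
  constructor
  · intro hφ
    refine ⟨mem_rangeSpace_of_mem_multipliers ha₁ hφ, ?_,
      bounded_of_mul_mem (mul_toDisk_mem_range ha₁ ha₂ hφ)⟩
    obtain ⟨F, hF, hφF⟩ := hφ.1
    exact ⟨fun z => b.eval z * F z, b.differentiable.differentiableOn.mul hF, fun z => by
      simp only [hφF]⟩
  · rintro ⟨hφ, hb⟩
    exact mem_multipliers_of_bounded ha₁ ha₂ hφ hb
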